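/- Let $a\ge 3$ be an integer, let $\rho>1$ be a root of the polynomial $x^3+(a-1)x^2-ax-1$, and let $N$ denote the norm from $\mathbb{Q}(\rho)$ to $\mathbb{Q}$. Then every $\alpha\in\mathbb{Z}[\rho]$ satisfies $|N(\alpha)|\ge 2a-3$ or is associated in $\mathbb{Z}[\rho]$ to a rational integer (that is, $\alpha=n\varepsilon$ for some $n\in\mathbb{Z}$ and some unit $\varepsilon$ of $\mathbb{Z}[\rho]$). The bound is attained by $-1+\rho^2$: this element is not associated in $\mathbb{Z}[\rho]$ to any rational integer, and $|N(-1+\rho^2)|=2a-3$. -/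

import Mathlib

open scoped IntermediateField

/-- The order `ℤ[ρ]`, as a subring of the field `ℚ(ρ)`. -/
noncomputable abbrev rootOrder (ρ : ℝ) : Subalgebra ℤ ℚ⟮ρ⟯ :=
  Algebra.adjoin ℤ {IntermediateField.AdjoinSimple.gen ℚ ρ}

/-- The generator `ρ`, as an element of the order `ℤ[ρ]`. -/
noncomputable def rootInOrder (ρ : ℝ) : rootOrder ρ :=
  ⟨IntermediateField.AdjoinSimple.gen ℚ ρ, Algebra.self_mem_adjoin_singleton ℤ _⟩

/-!
The elements `ρ`, `ρ - 1` and `ρ + a` are units with product `1`. Let `M = √(2a - 4)`. Under the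
embeddings `ρ ↦ r₁`, `ρ ↦ r₂` with `r₁ ≈ 1` and `r₂ ≈ 0`, multiplication by `ρ + a` enlarges both
conjugates, while `ρ - 1` shrinks the first and enlarges the second, and `ρ` does the converse.
Hence every nonzero `α` has an associate whose first two conjugates are at least `M` in absolute
value, while multiplication by `ρ - 1` takes the first one below `M` and multiplication by `ρ` the
second one. If `|N(α)| < 2a - 3`, then `|N(α)| ≤ M²`, so the third conjugate is at most `1`. Write
this associate as `x + y / (ρ - 1) + z / ρ`; the three bounds give `y, z = O(√a)`. For `a ≥ 22` they
force `y = z = 0` or `x = 0`, and in the latter case the norm is `(y + z)³ + yz(ay + (a + 1)z)`,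
which is easily bounded. For `a ≤ 21` only finitely many coordinates remain.
-/

section Ring

variable {R S : Type*} [CommRing R] [CommRing S] {a : ℤ} {r : R}

/-- The element `x + y / (r - 1) + z / r` for a root `r` of `X(X - 1)(X + a) - 1`. The inverses are
written as `(r - 1)⁻¹ = r(r + a)` and `r⁻¹ = (r - 1)(r + a)`, so that the definition makes sense in
every commutative ring. -/
def ofCoords (a : ℤ) (r : R) (x y z : ℤ) : R :=
  x + y * (r * (r + a)) + z * ((r - 1) * (r + a))

/-- The norm of `ofCoords a r x y z`, as a cubic form in the coordinates. -/
def normForm (a x y z : ℤ) : ℤ :=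
  x ^ 3 + x ^ 2 * ((a + 1) * y - a * z)
    - x * ((a + 2) * y ^ 2 + (a - 1) * z ^ 2 + (a ^ 2 + 3 * a + 1) * (y * z))
    + (y + z) ^ 3 + y * z * (a * y + (a + 1) * z)

theorem map_ofCoords (σ : R →+* S) (x y z : ℤ) :
    σ (ofCoords a r x y z) = ofCoords a (σ r) x y z := by
  simp [ofCoords]

theorem ofCoords_intCast_mul (m x y z : ℤ) :
    ofCoords a r (m * x) (m * y) (m * z) = m * ofCoords a r x y z := by
  simp only [ofCoords]; push_cast; ring

theorem normForm_mul (a m x y z : ℤ) :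
    normForm a (m * x) (m * y) (m * z) = m ^ 3 * normForm a x y z := by
  simp only [normForm]; ring

theorem normForm_neg (a x y z : ℤ) : normForm a (-x) (-y) (-z) = -normForm a x y z := by
  simp only [normForm]; ring

theorem ofCoords_dvd_normForm (hr : r * (r - 1) * (r + a) = 1) (x y z : ℤ) :
    ofCoords a r x y z ∣ (normForm a x y z : R) := by
  -- The cofactor, the product of the other two conjugates, comes from the adjugate of the matrix of
  -- multiplication by `x + y u + z v` in the basis `1, u, v`.
  let A : R := (x + (a + 2) * y + z) * (x - y - (a + 1) * z) + (y + z) ^ 2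
  let B : R := (y + z) * z - y * (x - y - (a + 1) * z)
  let C : R := -y * (y + z) - (x + (a + 2) * y + z) * z
  have mul_table : ∃ u v : R, ofCoords a r x y z = x + y * u + z * v ∧
      u * u = (a + 2) * u - v + 1 ∧ u * v = u - v ∧ v * v = u - (a + 1) * v - 1 :=
    ⟨r * (r + a), (r - 1) * (r + a), rfl, by linear_combination (r + a + 1) * hr,
      by linear_combination (r + a) * hr, by linear_combination (r + a - 1) * hr⟩
  obtain ⟨u, v, h, huu, huv, hvv⟩ := mul_table
  refine ⟨A + B * u + C * v, ?_⟩
  simp only [h, normForm, A, B, C]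
  push_cast
  linear_combination -y * B * huu - (y * C + z * B) * huv - z * C * hvv

theorem isUnit_ofCoords (hr : r * (r - 1) * (r + a) = 1) {x y z : ℤ}
    (h : IsUnit (normForm a x y z)) : IsUnit (ofCoords a r x y z) :=
  isUnit_of_dvd_unit (ofCoords_dvd_normForm hr x y z) (h.map (Int.castRingHom R))

theorem associated_intCast_of_abs_normForm_eq (hr : r * (r - 1) * (r + a) = 1) {x y z m : ℤ}
    (hx : m ∣ x) (hy : m ∣ y) (hz : m ∣ z) (hN : |normForm a x y z| = |m| ^ 3) :
    Associated (ofCoords a r x y z) (m : R) := by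
  obtain ⟨x, rfl⟩ := hx
  obtain ⟨y, rfl⟩ := hy
  obtain ⟨z, rfl⟩ := hz
  rw [ofCoords_intCast_mul]
  rcases eq_or_ne m 0 with rfl | hm
  · simp
  rw [normForm_mul, abs_mul, abs_pow, mul_eq_left₀ (pow_ne_zero 3 (abs_ne_zero.2 hm))] at hN
  exact associated_mul_unit_left _ _ (isUnit_ofCoords hr (Int.isUnit_iff_abs_eq.2 hN))

theorem sum_prod_roots [IsDomain R] {r₁ r₂ r₃ : R} (h₁ : r₁ * (r₁ - 1) * (r₁ + a) = 1)
    (h₂ : r₂ * (r₂ - 1) * (r₂ + a) = 1) (h₃ : r₃ * (r₃ - 1) * (r₃ + a) = 1)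
    (h₁₂ : r₁ ≠ r₂) (h₁₃ : r₁ ≠ r₃) (h₂₃ : r₂ ≠ r₃) :
    r₁ + r₂ + r₃ = 1 - a ∧ r₁ * r₂ + r₁ * r₃ + r₂ * r₃ = -a ∧ r₁ * r₂ * r₃ = 1 := by
  have e₁₂ : r₁ ^ 2 + r₁ * r₂ + r₂ ^ 2 + (a - 1) * (r₁ + r₂) - a = 0 :=
    mul_left_cancel₀ (sub_ne_zero.2 h₁₂) (by linear_combination h₁ - h₂)
  have e₁₃ : r₁ ^ 2 + r₁ * r₃ + r₃ ^ 2 + (a - 1) * (r₁ + r₃) - a = 0 :=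
    mul_left_cancel₀ (sub_ne_zero.2 h₁₃) (by linear_combination h₁ - h₃)
  have hsum : r₁ + r₂ + r₃ + (a - 1) = 0 :=
    mul_left_cancel₀ (sub_ne_zero.2 h₂₃) (by linear_combination e₁₂ - e₁₃)
  have hpair : r₁ * r₂ + r₁ * r₃ + r₂ * r₃ = -a := by
    linear_combination (r₁ + r₂) * hsum - e₁₂
  exact ⟨by linear_combination hsum, hpair, by
    linear_combination h₁ - r₁ ^ 2 * hsum + r₁ * hpair⟩

theorem ofCoords_mul_ofCoords_mul_ofCoords {r₁ r₂ r₃ : R} (hsum : r₁ + r₂ + r₃ = 1 - a)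
    (hpair : r₁ * r₂ + r₁ * r₃ + r₂ * r₃ = -a) (hprod : r₁ * r₂ * r₃ = 1) (x y z : ℤ) :
    ofCoords a r₁ x y z * ofCoords a r₂ x y z * ofCoords a r₃ x y z = normForm a x y z := by
  have key (p q s : R) : (p + q * r₁ + s * r₁ ^ 2) * (p + q * r₂ + s * r₂ ^ 2) *
      (p + q * r₃ + s * r₃ ^ 2) =
      p ^ 3 + p ^ 2 * q * (r₁ + r₂ + r₃)
      + p ^ 2 * s * ((r₁ + r₂ + r₃) ^ 2 - 2 * (r₁ * r₂ + r₁ * r₃ + r₂ * r₃))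
      + p * q ^ 2 * (r₁ * r₂ + r₁ * r₃ + r₂ * r₃)
      + p * q * s * ((r₁ + r₂ + r₃) * (r₁ * r₂ + r₁ * r₃ + r₂ * r₃) - 3 * (r₁ * r₂ * r₃))
      + p * s ^ 2 * ((r₁ * r₂ + r₁ * r₃ + r₂ * r₃) ^ 2 - 2 * (r₁ + r₂ + r₃) * (r₁ * r₂ * r₃))
      + q ^ 3 * (r₁ * r₂ * r₃) + q ^ 2 * s * ((r₁ + r₂ + r₃) * (r₁ * r₂ * r₃))
      + q * s ^ 2 * ((r₁ * r₂ + r₁ * r₃ + r₂ * r₃) * (r₁ * r₂ * r₃))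
      + s ^ 3 * (r₁ * r₂ * r₃) ^ 2 := by ring
  rw [hsum, hpair, hprod] at key
  have e (r : R) : ofCoords a r x y z =
      (x - a * z) + (a * y + (a - 1) * z) * r + (y + z) * r ^ 2 := by
    simp only [ofCoords]; ring
  rw [e, e, e, key, normForm]
  push_cast; ring

end Ring

theorem ofCoords_eq_inv {K : Type*} [Field K] {a : ℤ} {r : K} (hr : r * (r - 1) * (r + a) = 1)
    (x y z : ℤ) : ofCoords a r x y z = x + y * (r - 1)⁻¹ + z * r⁻¹ := by
  have hsub : (r - 1) * (r * (r + a)) = 1 := by linear_combination hr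
  have hself : r * ((r - 1) * (r + a)) = 1 := by linear_combination hr
  rw [ofCoords, eq_inv_of_mul_eq_one_right hsub, eq_inv_of_mul_eq_one_right hself]

section Polynomial

open Polynomial

/-- Ennola's cubic `X ^ 3 + (a - 1) X ^ 2 - a X - 1 = X (X - 1) (X + a) - 1`. -/
noncomputable def ennolaPoly (a : ℤ) : ℤ[X] :=
  X ^ 3 + C (a - 1) * X ^ 2 - C a * X - 1

theorem monic_ennolaPoly (a : ℤ) : (ennolaPoly a).Monic := by
  rw [ennolaPoly]
  monicity!

theorem natDegree_ennolaPoly (a : ℤ) : (ennolaPoly a).natDegree = 3 := by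
  rw [ennolaPoly]
  compute_degree!

theorem aeval_ennolaPoly {R : Type*} [CommRing R] (a : ℤ) (r : R) :
    aeval r (ennolaPoly a) = r * (r - 1) * (r + a) - 1 := by
  simp only [ennolaPoly, map_sub, map_add, map_mul, map_pow, map_one, map_intCast, aeval_X,
    eq_intCast]
  ring

theorem irreducible_ennolaPoly (a : ℤ) : Irreducible (ennolaPoly a) := by
  have hdeg := natDegree_ennolaPoly a
  rw [(monic_ennolaPoly a).irreducible_iff_roots_eq_zero_of_degree_le_three (by lia) (by lia)]
  refine Multiset.eq_zero_of_forall_notMem fun k hk => ?_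
  have hroot : k * (k - 1) * (k + a) = 1 := by
    have := aeval_ennolaPoly a k
    rw [coe_aeval_eq_eval, (mem_roots'.1 hk).2, Int.cast_id] at this
    linarith
  -- An integer root `k` would make the even number `k (k - 1)` a unit.
  have heven : Even (k * (k - 1) * (k + a)) := (Int.even_mul_pred_self k).mul_right _
  rw [hroot] at heven
  exact absurd heven (by decide)

variable {R : Type*} [CommRing R] {a : ℤ} {r : R}

theorem isIntegral_root (hr : r * (r - 1) * (r + a) = 1) : IsIntegral ℤ r :=
  ⟨ennolaPoly a, monic_ennolaPoly a, (aeval_ennolaPoly a r).trans (by rw [hr, sub_self])⟩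

theorem minpoly_int_eq_ennolaPoly [IsDomain R] [CharZero R] (hr : r * (r - 1) * (r + a) = 1) :
    minpoly ℤ r = ennolaPoly a := by
  have hdvd : minpoly ℤ r ∣ ennolaPoly a :=
    minpoly.isIntegrallyClosed_dvd (isIntegral_root hr) (by rw [aeval_ennolaPoly, hr, sub_self])
  exact eq_of_monic_of_associated (minpoly.monic (isIntegral_root hr)) (monic_ennolaPoly a)
    ((minpoly.irreducible (isIntegral_root hr)).associated_of_dvd (irreducible_ennolaPoly a) hdvd)

theorem ofCoords_eq_zero_iff [IsDomain R] [CharZero R] (hr : r * (r - 1) * (r + a) = 1)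
    {x y z : ℤ} : ofCoords a r x y z = 0 ↔ x = 0 ∧ y = 0 ∧ z = 0 := by
  refine ⟨fun h => ?_, by rintro ⟨rfl, rfl, rfl⟩; simp [ofCoords]⟩
  let q : ℤ[X] := C (y + z) * X ^ 2 + C (a * y + (a - 1) * z) * X + C (x - a * z)
  have hq : aeval r q = 0 := by
    rw [← h]
    simp only [q, ofCoords, map_add, map_sub, map_mul, map_pow, map_one, map_intCast, aeval_X,
      eq_intCast]
    ring
  have hdvd := minpoly.isIntegrallyClosed_dvd (isIntegral_root hr) hq
  rw [minpoly_int_eq_ennolaPoly hr] at hdvd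
  have hq0 : q = 0 := eq_zero_of_dvd_of_natDegree_lt hdvd <| by
    rw [natDegree_ennolaPoly]
    exact natDegree_quadratic_le.trans_lt (by norm_num)
  have hcoeff (n : ℕ) : q.coeff n = 0 := by rw [hq0, coeff_zero]
  simp only [q, coeff_add, coeff_C_mul, coeff_X_pow, coeff_X, coeff_C] at hcoeff
  have h₀ : x - a * z = 0 := by simpa using hcoeff 0
  have h₁ : a * y + (a - 1) * z = 0 := by simpa using hcoeff 1
  have h₂ : y + z = 0 := by simpa using hcoeff 2
  have hz : z = 0 := by linear_combination a * h₂ - h₁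
  subst hz
  exact ⟨by simpa using h₀, by simpa using h₂, rfl⟩

theorem exists_ofCoords_eq_of_mem_adjoin (hr : r * (r - 1) * (r + a) = 1) {α : R}
    (hα : α ∈ Algebra.adjoin ℤ {r}) : ∃ x y z, ofCoords a r x y z = α := by
  rw [Algebra.adjoin_singleton_eq_range_aeval] at hα
  obtain ⟨p, rfl : aeval r p = α⟩ := hα
  have hroot : aeval r (ennolaPoly a) = 0 := by rw [aeval_ennolaPoly, hr, sub_self]
  set q := p %ₘ ennolaPoly a with hq
  have hne : ennolaPoly a ≠ 1 := fun h => by simpa [h] using natDegree_ennolaPoly a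
  have hdeg : q.natDegree < 3 := by
    rw [hq, ← natDegree_ennolaPoly a]
    exact natDegree_modByMonic_lt p (monic_ennolaPoly a) hne
  have hp : aeval r p = q.coeff 0 + q.coeff 1 * r + q.coeff 2 * r ^ 2 := by
    rw [← aeval_modByMonic_eq_self_of_root hroot, aeval_eq_sum_range' hdeg]
    simp [Finset.sum_range_succ]
  refine ⟨q.coeff 0 + a * (a * q.coeff 2 - q.coeff 1), q.coeff 2 - (a * q.coeff 2 - q.coeff 1),
    a * q.coeff 2 - q.coeff 1, ?_⟩
  rw [hp, ofCoords]
  push_cast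
  ring

end Polynomial

theorem algebraMap_norm_eq_prod_of_injective {K L E ι : Type*} [Field K] [Field L] [Field E]
    [Algebra K L] [Algebra K E] [FiniteDimensional K L] [Algebra.IsSeparable K L] [Fintype ι]
    {σ : ι → L →ₐ[K] E} (hσ : Function.Injective σ) (hcard : Fintype.card ι = Module.finrank K L)
    (α : L) : algebraMap K E (Algebra.norm K α) = ∏ i, σ i α := by
  let τ (i : ι) : L →ₐ[K] AlgebraicClosure E := (IsScalarTower.toAlgHom K E _).comp (σ i)
  have hτ : Function.Bijective τ := by
    refine (Fintype.bijective_iff_injective_and_card τ).2 ⟨fun i j hij => hσ ?_, ?_⟩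
    · ext α
      exact (algebraMap E (AlgebraicClosure E)).injective (DFunLike.congr_fun hij α)
    · rw [hcard, AlgHom.card]
  refine (algebraMap E (AlgebraicClosure E)).injective ?_
  rw [← IsScalarTower.algebraMap_apply, Algebra.norm_eq_prod_embeddings, ← hτ.prod_comp, map_prod]
  rfl

/-- The coordinates are those of an integer multiple of a unit, as witnessed by the norm. -/
def IsIntMulUnit (a x y z : ℤ) : Prop :=
  ∃ m : ℤ, m ∣ x ∧ m ∣ y ∧ m ∣ z ∧ |normForm a x y z| = |m| ^ 3

theorem isIntMulUnit_neg {a x y z : ℤ} :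
    IsIntMulUnit a (-x) (-y) (-z) ↔ IsIntMulUnit a x y z := by
  simp only [IsIntMulUnit, normForm_neg, abs_neg, dvd_neg]

theorem two_mul_sub_three_le_of_lt {a y e : ℤ} (hy : 1 ≤ y) (he : 1 ≤ e) (hea : e < a) :
    2 * a - 3 ≤ y * (y + e) * (y + (a + 1) * e) - e ^ 3 := by
  have ha : 0 ≤ (a + 1) * e := by nlinarith
  have hmin : 1 * (1 + e) * (1 + (a + 1) * e) ≤ y * (y + e) * (y + (a + 1) * e) := by
    gcongr
  nlinarith [mul_nonneg (sq_nonneg e) (sub_nonneg.2 (Int.le_sub_one_of_lt hea)),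
    mul_le_mul_of_nonneg_left he (by lia : 0 ≤ a)]

theorem two_mul_sub_three_le_of_gt {a t d : ℤ} (ht : 1 ≤ t) (hta : t < a) (hd : 1 ≤ d)
    (hda : d < a) : 2 * a - 3 ≤ (t + d) * (t * (a * d - t)) - d ^ 3 := by
  have hmid : t ≤ a * d - 1 := by nlinarith
  have hconcave : a * d - 1 ≤ t * (a * d - t) := by
    linarith [mul_nonneg (sub_nonneg.2 ht) (sub_nonneg.2 hmid)]
  have hmin : (1 + d) * (a * d - 1) ≤ (t + d) * (t * (a * d - t)) := by
    gcongr
    linarith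
  nlinarith [mul_nonneg (sq_nonneg d) (sub_nonneg.2 (Int.le_sub_one_of_lt hda)),
    mul_le_mul_of_nonneg_left hd (by lia : 0 ≤ a - 1)]

theorem le_abs_normForm_or_isIntMulUnit_of_fst_eq_zero {a y z : ℤ} (ha : 3 ≤ a) (hy : |y| ≤ a)
    (hz : |z| ≤ a) : 2 * a - 3 ≤ |normForm a 0 y z| ∨ IsIntMulUnit a 0 y z := by
  wlog hy0 : 0 ≤ y generalizing y z
  · have h := this (y := -y) (z := -z) (by rwa [abs_neg]) (by rwa [abs_neg]) (by lia)
    rwa [← neg_zero, normForm_neg, abs_neg, isIntMulUnit_neg] at h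
  rw [abs_le] at hy hz
  rcases hy0.eq_or_lt with rfl | hy0
  · exact .inr ⟨z, dvd_zero z, dvd_zero z, dvd_rfl, by simp [normForm, abs_pow]⟩
  rcases lt_trichotomy z 0 with hz0 | rfl | hz0
  · rcases lt_trichotomy y (-z) with hyz | rfl | hyz
    · have h := two_mul_sub_three_le_of_lt (a := a) hy0 (e := -z - y) (by lia) (by lia)
      exact .inl (le_abs.2 (.inl (h.trans_eq (by simp only [normForm]; ring))))
    · exact .inr ⟨z, dvd_zero z, dvd_neg.2 dvd_rfl, dvd_rfl,
        by rw [← abs_pow, ← abs_neg]; simp only [normForm]; ring_nf⟩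
    · have h := two_mul_sub_three_le_of_gt (a := a) (t := -z) (d := y + z)
        (by lia) (by lia) (by lia) (by lia)
      exact .inl (le_abs.2 (.inr (h.trans_eq (by simp only [normForm]; ring))))
  · exact .inr ⟨y, dvd_zero y, dvd_rfl, dvd_zero y, by simp [normForm, abs_pow]⟩
  · have hyz : 1 ≤ y * z := by nlinarith
    have hcross : 1 * (a * 1 + (a + 1) * 1) ≤ y * z * (a * y + (a + 1) * z) := by
      gcongr <;> lia
    refine .inl (le_abs.2 (.inl ?_))
    simp only [normForm]
    linarith [pow_nonneg (add_nonneg hy0.le hz0.le) 3]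

-- The hypothesis on `W` is `(2 * a - 3) * W ≤ 2 * a * √(2 * a - 4) + 2` without the square root.
theorem le_abs_normForm_or_exists_dvd_of_mem_Icc :
    ∀ a ∈ Finset.Icc (3 : ℤ) 21, ∀ W ∈ Finset.Icc (0 : ℤ) a,
      ((2 * a - 3) * W - 2) ^ 2 ≤ 8 * a ^ 2 * (a - 2) →
      ∀ x ∈ Finset.Icc (1 : ℤ) 4, (a - 1) * (x - 1) ≤ 2 * W →
      ∀ y ∈ Finset.Icc (-W) W, ∀ z ∈ Finset.Icc (-W) W, 2 * a - 3 ≤ |normForm a x y z| ∨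
        ∃ m ∈ Finset.Icc (1 : ℤ) 2, m ∣ x ∧ m ∣ y ∧ m ∣ z ∧ |normForm a x y z| = |m| ^ 3 := by
  decide +kernel

theorem le_of_sq_mul_sub_two_le {a W : ℤ} (ha : 3 ≤ a)
    (hW : ((2 * a - 3) * W - 2) ^ 2 ≤ 8 * a ^ 2 * (a - 2)) : W ≤ a := by
  by_contra! h
  have hlin : (2 * a - 3) * (a + 1) - 2 ≤ (2 * a - 3) * W - 2 := by
    gcongr <;> lia
  have hsq : ((2 * a - 3) * (a + 1) - 2) ^ 2 ≤ ((2 * a - 3) * W - 2) ^ 2 := by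
    gcongr
    nlinarith
  have := hsq.trans hW
  obtain ⟨b, rfl⟩ := Int.le.dest ha
  ring_nf at this
  nlinarith [pow_nonneg (Int.natCast_nonneg b) 2, pow_nonneg (Int.natCast_nonneg b) 3,
    pow_nonneg (Int.natCast_nonneg b) 4]

theorem isIntMulUnit_zero_zero (a x : ℤ) : IsIntMulUnit a x 0 0 :=
  ⟨x, dvd_rfl, dvd_zero x, dvd_zero x, by simp [normForm, abs_pow]⟩

theorem le_abs_normForm_or_isIntMulUnit_of_le {a x y z W : ℤ} (ha : 3 ≤ a) (ha' : a ≤ 21)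
    (hy : |y| ≤ W) (hz : |z| ≤ W) (hW : ((2 * a - 3) * W - 2) ^ 2 ≤ 8 * a ^ 2 * (a - 2))
    (hx : (a - 1) * (|x| - 1) ≤ 2 * W) :
    2 * a - 3 ≤ |normForm a x y z| ∨ IsIntMulUnit a x y z := by
  wlog hx0 : 0 ≤ x generalizing x y z
  · have h := this (x := -x) (y := -y) (z := -z) (by rwa [abs_neg]) (by rwa [abs_neg])
      (by rwa [abs_neg]) (by lia)
    rwa [normForm_neg, abs_neg, isIntMulUnit_neg] at h
  have hWa : W ≤ a := le_of_sq_mul_sub_two_le ha hW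
  rcases hx0.eq_or_lt with rfl | hx0
  · exact le_abs_normForm_or_isIntMulUnit_of_fst_eq_zero ha (hy.trans hWa) (hz.trans hWa)
  rw [abs_of_pos hx0] at hx
  have hx4 : x ≤ 4 := by nlinarith
  have hW0 : 0 ≤ W := (abs_nonneg y).trans hy
  exact (le_abs_normForm_or_exists_dvd_of_mem_Icc a (Finset.mem_Icc.2 ⟨ha, ha'⟩)
    W (Finset.mem_Icc.2 ⟨hW0, hWa⟩) hW x (Finset.mem_Icc.2 ⟨hx0, hx4⟩) hx
    y (Finset.mem_Icc.2 (abs_le.1 hy)) z (Finset.mem_Icc.2 (abs_le.1 hz))).imp_right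
      fun ⟨m, _, h⟩ => ⟨m, h⟩

theorem mul_abs_le_of_mul_eq {a t c y α β w : ℝ} (ha : 0 ≤ a) (ht : 0 ≤ t) (hta : t * a ≤ 1)
    (hc : 1 ≤ |c|) (h : c * y = t * (α - β - w)) : a * |y| ≤ a * (t * |α|) + |β| + |w| :=
  calc a * |y| ≤ a * |c * y| := by
        rw [abs_mul]
        gcongr
        exact le_mul_of_one_le_left (abs_nonneg y) hc
    _ ≤ a * (t * (|α| + |β| + |w|)) := by
        rw [h, abs_mul, abs_of_nonneg ht]
        gcongr
        exact (abs_sub _ _).trans (by gcongr; exact abs_sub _ _)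
    _ = a * (t * |α|) + t * a * |β| + t * a * |w| := by ring
    _ ≤ a * (t * |α|) + 1 * |β| + 1 * |w| := by gcongr
    _ = _ := by simp only [one_mul]

theorem abs_le_div_of_mul_mul_le_sq {M c α β γ : ℝ} (hM : 0 < M) (hc : 0 < c) (hβ : M ≤ |β|)
    (hγ : c ≤ |γ|) (h : |α| * |β| * |γ| ≤ M ^ 2) : |α| ≤ M / c := by
  have hle : |α| * M * c ≤ |α| * |β| * |γ| := by gcongr
  rw [le_div_iff₀ hc]
  exact le_of_mul_le_mul_right (by linarith : |α| * c * M ≤ M * M) hM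

/-- Both real numbers have absolute value at least `M`, but multiplication by `t` takes the first
one below `M` and multiplication by `s` the second one. -/
structure IsReducedPair (M t s α β : ℝ) : Prop where
  le_abs_fst : M ≤ |α|
  le_abs_snd : M ≤ |β|
  abs_mul_fst_lt : |t * α| < M
  abs_mul_snd_lt : |s * β| < M

section Conjugates

/-- `r₁`, `r₂`, `r₃` are the three real roots of `X(X - 1)(X + a) - 1`, listed in decreasing order
and each located near one of the roots `1`, `0`, `-a` of `X(X - 1)(X + a)`. -/
structure EnnolaConjugates (a : ℤ) (r₁ r₂ r₃ : ℝ) : Prop where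
  root₁ : r₁ * (r₁ - 1) * (r₁ + a) = 1
  root₂ : r₂ * (r₂ - 1) * (r₂ + a) = 1
  root₃ : r₃ * (r₃ - 1) * (r₃ + a) = 1
  one_lt : 1 < r₁
  mem_Ioo₂ : r₂ ∈ Set.Ioo (-1) 0
  mem_Ioo₃ : r₃ ∈ Set.Ioo (-a : ℝ) (-a + 1)

theorem exists_ennolaConjugates {a : ℤ} (ha : 2 ≤ a) : ∃ r₁ r₂ r₃, EnnolaConjugates a r₁ r₂ r₃ := by
  have ha' : (2 : ℝ) ≤ a := mod_cast ha
  let f (t : ℝ) : ℝ := t * (t - 1) * (t + a)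
  have hf (s : Set ℝ) : ContinuousOn f s := by fun_prop
  obtain ⟨r₁, hr₁, h₁⟩ := intermediate_value_Ioo (by norm_num : (1 : ℝ) ≤ 2) (hf _)
    (show (1 : ℝ) ∈ Set.Ioo _ _ by constructor <;> simp only [f] <;> nlinarith)
  obtain ⟨r₂, hr₂, h₂⟩ := intermediate_value_Ioo' (by norm_num : (-1 : ℝ) ≤ 0) (hf _)
    (show (1 : ℝ) ∈ Set.Ioo _ _ by constructor <;> simp only [f] <;> nlinarith)
  obtain ⟨r₃, hr₃, h₃⟩ := intermediate_value_Ioo (by linarith : (-a : ℝ) ≤ -a + 1) (hf _)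
    (show (1 : ℝ) ∈ Set.Ioo _ _ by constructor <;> simp only [f] <;> nlinarith)
  exact ⟨r₁, r₂, r₃, h₁, h₂, h₃, hr₁.1, hr₂, hr₃⟩

namespace EnnolaConjugates

variable {a : ℤ} {r₁ r₂ r₃ : ℝ} {x y z : ℤ}

theorem sub_one_mul_le_one (h : EnnolaConjugates a r₁ r₂ r₃) (ha : 0 ≤ a) : (r₁ - 1) * a ≤ 1 := by
  have ha' : (0 : ℝ) ≤ a := mod_cast ha
  have := h.one_lt
  calc (r₁ - 1) * a ≤ (r₁ - 1) * (r₁ * (r₁ + a)) := by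
        gcongr
        nlinarith
    _ = 1 := by linear_combination h.root₁

theorem neg_mul_le_one (h : EnnolaConjugates a r₁ r₂ r₃) (ha : 2 ≤ a) : -r₂ * a ≤ 1 := by
  have ha' : (2 : ℝ) ≤ a := mod_cast ha
  obtain ⟨hr, hr'⟩ := h.mem_Ioo₂
  calc -r₂ * a ≤ -r₂ * ((1 - r₂) * (r₂ + a)) := by
        gcongr
        · linarith
        · nlinarith
    _ = 1 := by linear_combination h.root₂

theorem injective (h : EnnolaConjugates a r₁ r₂ r₃) (ha : 2 ≤ a) :
    Function.Injective ![r₁, r₂, r₃] := by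
  have ha' : (2 : ℝ) ≤ a := mod_cast ha
  have h₁ := h.one_lt
  obtain ⟨h₂, h₂'⟩ := h.mem_Ioo₂
  have h₃ := h.mem_Ioo₃.2
  have : StrictAnti ![r₁, r₂, r₃] := by
    refine Fin.strictAnti_iff_succ_lt.2 fun i => ?_
    fin_cases i
    · exact h₂'.trans (zero_lt_one.trans h₁)
    · exact h₃.trans (by linarith : (-a + 1 : ℝ) < r₂)
  exact this.injective

theorem ofCoords_mul_ofCoords_mul_ofCoords (h : EnnolaConjugates a r₁ r₂ r₃) (ha : 2 ≤ a)
    (x y z : ℤ) :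
    ofCoords a r₁ x y z * ofCoords a r₂ x y z * ofCoords a r₃ x y z = normForm a x y z := by
  have hinj := h.injective ha
  obtain ⟨hsum, hpair, hprod⟩ := sum_prod_roots h.root₁ h.root₂ h.root₃
    (hinj.ne (by decide : (0 : Fin 3) ≠ 1)) (hinj.ne (by decide : (0 : Fin 3) ≠ 2))
    (hinj.ne (by decide : (1 : Fin 3) ≠ 2))
  exact _root_.ofCoords_mul_ofCoords_mul_ofCoords hsum hpair hprod x y z

theorem mul_abs_snd_le (h : EnnolaConjugates a r₁ r₂ r₃) (ha : 3 ≤ a) :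
    a * |(y : ℝ)| ≤ a * ((r₁ - 1) * |ofCoords a r₁ x y z|) + |ofCoords a r₃ x y z| +
      3 / 2 * |(z : ℝ)| := by
  have ha' : (3 : ℝ) ≤ a := mod_cast ha
  have h₁ := h.one_lt
  have h₃ := h.mem_Ioo₃.2
  have hp : 0 ≤ (1 - r₃)⁻¹ := inv_nonneg.2 (by linarith)
  have hq : |r₁⁻¹ - r₃⁻¹| ≤ 3 / 2 := by
    have hq₁ := inv_le_one_of_one_le₀ h₁.le
    have hq₃ := inv_anti₀ two_pos (by linarith : 2 ≤ -r₃)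
    rw [inv_neg] at hq₃
    have := inv_nonneg.2 (by linarith : 0 ≤ r₁)
    have := inv_nonpos.2 (by linarith : r₃ ≤ 0)
    exact abs_le.2 ⟨by linarith, by linarith⟩
  have helim : (1 + (r₁ - 1) * (1 - r₃)⁻¹) * y =
      (r₁ - 1) * (ofCoords a r₁ x y z - ofCoords a r₃ x y z - (r₁⁻¹ - r₃⁻¹) * z) := by
    rw [ofCoords_eq_inv h.root₁, ofCoords_eq_inv h.root₃, ← neg_sub 1 r₃, inv_neg]
    linear_combination -y * mul_inv_cancel₀ (sub_pos.2 h₁).ne'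
  refine (mul_abs_le_of_mul_eq (by linarith) (by linarith) (h.sub_one_mul_le_one (by lia))
    (le_abs.2 (.inl (le_add_of_nonneg_right (mul_nonneg (by linarith) hp)))) helim).trans ?_
  rw [abs_mul]
  gcongr

theorem mul_abs_trd_le (h : EnnolaConjugates a r₁ r₂ r₃) (ha : 3 ≤ a) :
    a * |(z : ℝ)| ≤ a * (-r₂ * |ofCoords a r₂ x y z|) + |ofCoords a r₃ x y z| +
      (|(y : ℝ)| + 1 / 2 * |(z : ℝ)|) := by
  have ha' : (3 : ℝ) ≤ a := mod_cast ha
  have h₂ := h.mem_Ioo₂.2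
  have h₃ := h.mem_Ioo₃.2
  have hp : |(1 - r₃)⁻¹ - (1 - r₂)⁻¹| ≤ 1 :=
    abs_sub_le_of_nonneg_of_le (inv_nonneg.2 (by linarith))
      (inv_le_one_of_one_le₀ (by linarith)) (inv_nonneg.2 (by linarith))
      (inv_le_one_of_one_le₀ (by linarith))
  have hq : |r₃⁻¹| ≤ 1 / 2 := by
    rw [abs_inv, one_div]
    exact inv_anti₀ two_pos (le_abs.2 (.inr (by linarith)))
  have helim : -1 * z = -r₂ * (ofCoords a r₂ x y z - ofCoords a r₃ x y z -
      (((1 - r₃)⁻¹ - (1 - r₂)⁻¹) * y - r₃⁻¹ * z)) := by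
    rw [ofCoords_eq_inv h.root₂, ofCoords_eq_inv h.root₃, ← neg_sub 1 r₂, ← neg_sub 1 r₃, inv_neg,
      inv_neg]
    linear_combination z * mul_inv_cancel₀ h₂.ne
  refine (mul_abs_le_of_mul_eq (by linarith) (by linarith) (h.neg_mul_le_one (by lia))
    (by simp) helim).trans ?_
  gcongr
  refine (abs_sub _ _).trans ?_
  rw [abs_mul, abs_mul]
  gcongr
  exact mul_le_of_le_one_left (abs_nonneg _) hp

theorem mul_abs_fst_le (h : EnnolaConjugates a r₁ r₂ r₃) (ha : 3 ≤ a) :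
    (a - 1) * |(x : ℝ)| ≤ (a - 1) * |ofCoords a r₃ x y z| + |(y : ℝ)| + |(z : ℝ)| := by
  have ha' : (3 : ℝ) ≤ a := mod_cast ha
  have h₃ := h.mem_Ioo₃.2
  have hp : (a - 1) * |(r₃ - 1)⁻¹| ≤ 1 := by
    rw [abs_inv, ← div_eq_mul_inv]
    exact div_le_one_of_le₀ (le_abs.2 (.inr (by linarith))) (abs_nonneg _)
  have hq : (a - 1) * |r₃⁻¹| ≤ 1 := by
    rw [abs_inv, ← div_eq_mul_inv]
    exact div_le_one_of_le₀ (le_abs.2 (.inr (by linarith))) (abs_nonneg _)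
  have hx : (x : ℝ) = ofCoords a r₃ x y z - y * (r₃ - 1)⁻¹ - z * r₃⁻¹ := by
    rw [ofCoords_eq_inv h.root₃]
    ring
  generalize ofCoords a r₃ x y z = α₃ at *
  have ha₀ : (0 : ℝ) ≤ a - 1 := by linarith
  calc (a - 1) * |(x : ℝ)|
      ≤ (a - 1) * (|α₃| + |(y : ℝ)| * |(r₃ - 1)⁻¹| + |(z : ℝ)| * |r₃⁻¹|) := by
        rw [hx, ← abs_mul, ← abs_mul]
        gcongr
        exact (abs_sub _ _).trans (by gcongr; exact abs_sub _ _)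
    _ = (a - 1) * |α₃| + (a - 1) * |(r₃ - 1)⁻¹| * |(y : ℝ)| + (a - 1) * |r₃⁻¹| * |(z : ℝ)| := by
        ring
    _ ≤ (a - 1) * |α₃| + 1 * |(y : ℝ)| + 1 * |(z : ℝ)| := by gcongr
    _ = _ := by simp only [one_mul]

theorem mul_max_abs_le (h : EnnolaConjugates a r₁ r₂ r₃) (ha : 3 ≤ a) {T : ℝ}
    (h₁ : |(r₁ - 1) * ofCoords a r₁ x y z| ≤ T) (h₂ : |r₂ * ofCoords a r₂ x y z| ≤ T) :
    (2 * a - 3) * max |(y : ℝ)| |(z : ℝ)| ≤ 2 * a * T + 2 * |ofCoords a r₃ x y z| := by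
  have ha' : (3 : ℝ) ≤ a := mod_cast ha
  rw [abs_mul, abs_of_pos (sub_pos.2 h.one_lt)] at h₁
  rw [abs_mul, abs_of_neg h.mem_Ioo₂.2] at h₂
  have hT₁ := mul_le_mul_of_nonneg_left h₁ (by linarith : (0 : ℝ) ≤ a)
  have hT₂ := mul_le_mul_of_nonneg_left h₂ (by linarith : (0 : ℝ) ≤ a)
  have hy := h.mul_abs_snd_le (x := x) (y := y) (z := z) ha
  have hz := h.mul_abs_trd_le (x := x) (y := y) (z := z) ha
  rcases max_cases |(y : ℝ)| |(z : ℝ)| with ⟨hmax, hle⟩ | ⟨hmax, hle⟩ <;> rw [hmax] <;> linarith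

theorem abs_trd_le_one (h : EnnolaConjugates a r₁ r₂ r₃) (ha : 2 ≤ a) {M t s : ℝ} (hM : 0 < M)
    (hred : IsReducedPair M t s (ofCoords a r₁ x y z) (ofCoords a r₂ x y z))
    (hN : |(normForm a x y z : ℝ)| ≤ M ^ 2) : |ofCoords a r₃ x y z| ≤ 1 := by
  rw [← h.ofCoords_mul_ofCoords_mul_ofCoords ha, abs_mul, abs_mul] at hN
  refine le_of_mul_le_mul_left (a := M * M) ?_ (by positivity)
  calc M * M * |ofCoords a r₃ x y z|
      ≤ |ofCoords a r₁ x y z| * |ofCoords a r₂ x y z| * |ofCoords a r₃ x y z| := by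
        gcongr
        exacts [hred.le_abs_fst, hred.le_abs_snd]
    _ ≤ M * M * 1 := by linarith

-- If `x ≠ 0`, the third conjugate is at least `1 / 3`, so the other two are at most
-- `3 * M ≤ a - 3`, which leaves room only for `y = z = 0`.
theorem snd_eq_zero_and_trd_eq_zero_of_reduced (h : EnnolaConjugates a r₁ r₂ r₃) (ha : 22 ≤ a)
    {M : ℝ} (hM : 0 < M) (hMa : M ^ 2 = 2 * a - 4)
    (hred : IsReducedPair M (r₁ - 1) r₂ (ofCoords a r₁ x y z) (ofCoords a r₂ x y z))
    (hN : |(normForm a x y z : ℝ)| ≤ M ^ 2) (hx : x ≠ 0) : y = 0 ∧ z = 0 := by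
  have ha' : (22 : ℝ) ≤ a := mod_cast ha
  have hMle : M / (1 / 3) ≤ a - 3 := (abs_le_of_sq_le_sq' (by ring_nf; nlinarith) (by linarith)).2
  have h₃ := h.abs_trd_le_one (by lia) hM hred hN
  have hfst := h.mul_abs_fst_le (x := x) (y := y) (z := z) (by lia)
  have hmax := h.mul_max_abs_le (by lia) hred.abs_mul_fst_lt.le hred.abs_mul_snd_lt.le
  have hyW := le_max_left |(y : ℝ)| |(z : ℝ)|
  have hzW := le_max_right |(y : ℝ)| |(z : ℝ)|
  have hthird : 1 / 3 ≤ |ofCoords a r₃ x y z| := by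
    have hW : 3 * max |(y : ℝ)| |(z : ℝ)| ≤ a - 1 := by nlinarith
    have hx1 : (1 : ℝ) ≤ |(x : ℝ)| := mod_cast Int.one_le_abs hx
    nlinarith
  rw [← h.ofCoords_mul_ofCoords_mul_ofCoords (by lia), abs_mul, abs_mul] at hN
  have hα₁ := (abs_le_div_of_mul_mul_le_sq hM (by norm_num) hred.le_abs_snd hthird hN).trans hMle
  have hα₂ := (abs_le_div_of_mul_mul_le_sq hM (by norm_num) hred.le_abs_fst hthird
    (by rwa [mul_comm |_| |_|])).trans hMle
  have hmax' := h.mul_max_abs_le (x := x) (y := y) (z := z) (T := (a - 3) / a) (by lia)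
    (by
      rw [abs_mul, le_div_iff₀ (by linarith), abs_of_pos (sub_pos.2 h.one_lt)]
      nlinarith [h.sub_one_mul_le_one (by lia), abs_nonneg (ofCoords a r₁ x y z)])
    (by
      rw [abs_mul, le_div_iff₀ (by linarith), abs_of_neg h.mem_Ioo₂.2]
      nlinarith [h.neg_mul_le_one (by lia), abs_nonneg (ofCoords a r₂ x y z)])
  rw [mul_assoc 2, mul_div_cancel₀ _ (by linarith : (a : ℝ) ≠ 0)] at hmax'
  have hlt : max |(y : ℝ)| |(z : ℝ)| < 1 := by nlinarith
  exact ⟨Int.abs_lt_one_iff.1 (mod_cast hyW.trans_lt hlt),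
    Int.abs_lt_one_iff.1 (mod_cast hzW.trans_lt hlt)⟩

theorem sq_max_abs_le_of_reduced (h : EnnolaConjugates a r₁ r₂ r₃) (ha : 3 ≤ a) {M : ℝ}
    (hM : 0 < M) (hMa : M ^ 2 = 2 * a - 4)
    (hred : IsReducedPair M (r₁ - 1) r₂ (ofCoords a r₁ x y z) (ofCoords a r₂ x y z))
    (hN : |(normForm a x y z : ℝ)| ≤ M ^ 2) :
    ((2 * a - 3) * max |y| |z| - 2) ^ 2 ≤ 8 * a ^ 2 * (a - 2) := by
  have ha' : (3 : ℝ) ≤ a := mod_cast ha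
  have h₃ := h.abs_trd_le_one (by lia) hM hred hN
  have hmax := h.mul_max_abs_le ha hred.abs_mul_fst_lt.le hred.abs_mul_snd_lt.le
  have hM1 : 1 ≤ M := by nlinarith
  have hmax0 : 0 ≤ (2 * a - 3) * max |(y : ℝ)| |(z : ℝ)| := by
    have : (0 : ℝ) ≤ 2 * a - 3 := by linarith
    positivity
  have hsq : ((2 * a - 3) * max |(y : ℝ)| |(z : ℝ)| - 2) ^ 2 ≤ (2 * a * M) ^ 2 :=
    sq_le_sq' (by nlinarith) (by linarith)
  rw [mul_pow, hMa] at hsq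
  have : ((2 * a - 3) * max |(y : ℝ)| |(z : ℝ)| - 2) ^ 2 ≤ 8 * a ^ 2 * (a - 2) := by linarith
  exact_mod_cast this

theorem mul_abs_fst_le_of_reduced (h : EnnolaConjugates a r₁ r₂ r₃) (ha : 3 ≤ a) {M t s : ℝ}
    (hM : 0 < M)
    (hred : IsReducedPair M t s (ofCoords a r₁ x y z) (ofCoords a r₂ x y z))
    (hN : |(normForm a x y z : ℝ)| ≤ M ^ 2) : (a - 1) * (|x| - 1) ≤ 2 * max |y| |z| := by
  have ha' : (3 : ℝ) ≤ a := mod_cast ha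
  have h₃ := h.abs_trd_le_one (by lia) hM hred hN
  have hfst := h.mul_abs_fst_le (x := x) (y := y) (z := z) ha
  have hy := le_max_left |(y : ℝ)| |(z : ℝ)|
  have hz := le_max_right |(y : ℝ)| |(z : ℝ)|
  have : (a - 1) * (|(x : ℝ)| - 1) ≤ 2 * max |(y : ℝ)| |(z : ℝ)| := by nlinarith
  exact_mod_cast this

theorem le_abs_normForm_or_isIntMulUnit (h : EnnolaConjugates a r₁ r₂ r₃) (ha : 3 ≤ a) {M : ℝ}
    (hM : 0 < M) (hMa : M ^ 2 = 2 * a - 4)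
    (hred : IsReducedPair M (r₁ - 1) r₂ (ofCoords a r₁ x y z) (ofCoords a r₂ x y z)) :
    2 * a - 3 ≤ |normForm a x y z| ∨ IsIntMulUnit a x y z := by
  refine or_iff_not_imp_left.2 fun hlt => ?_
  have hN : |(normForm a x y z : ℝ)| ≤ M ^ 2 := by
    rw [hMa]
    exact_mod_cast (by lia : |normForm a x y z| ≤ 2 * a - 4)
  have hy := le_max_left |y| |z|
  have hz := le_max_right |y| |z|
  have hW := h.sq_max_abs_le_of_reduced ha hM hMa hred hN
  rcases le_or_gt a 21 with ha21 | ha22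
  · have hx := h.mul_abs_fst_le_of_reduced ha hM hred hN
    exact (le_abs_normForm_or_isIntMulUnit_of_le ha ha21 hy hz hW hx).resolve_left hlt
  rcases eq_or_ne x 0 with rfl | hx
  · have hWa := le_of_sq_mul_sub_two_le ha hW
    exact (le_abs_normForm_or_isIntMulUnit_of_fst_eq_zero ha (hy.trans hWa)
      (hz.trans hWa)).resolve_left hlt
  · obtain ⟨rfl, rfl⟩ := h.snd_eq_zero_and_trd_eq_zero_of_reduced ha22 hM hMa hred hN hx
    exact isIntMulUnit_zero_zero a x

end EnnolaConjugates

end Conjugates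

section Reduction

variable {R F : Type*} [CommMonoid R] [FunLike F R ℝ] [MonoidHomClass F R ℝ] {f g : F} {α : R}

theorem exists_associated_le_abs {ω : R} (hω : IsUnit ω) (hf : 1 < |f ω|) (hg : 1 < |g ω|)
    (hfα : f α ≠ 0) (hgα : g α ≠ 0) (M : ℝ) :
    ∃ β, Associated α β ∧ M ≤ |f β| ∧ M ≤ |g β| := by
  have hlarge {c t : ℝ} (hc : 0 < c) (ht : 1 < t) : ∀ᶠ k : ℕ in Filter.atTop, M ≤ c * t ^ k :=
    ((tendsto_pow_atTop_atTop_of_one_lt ht).const_mul_atTop hc).eventually_ge_atTop M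
  obtain ⟨k, hkf, hkg⟩ := ((hlarge (abs_pos.2 hfα) hf).and (hlarge (abs_pos.2 hgα) hg)).exists
  refine ⟨α * ω ^ k, (associated_mul_unit_left α _ (hω.pow k)).symm, ?_, ?_⟩ <;>
    rwa [map_mul, map_pow, abs_mul, abs_pow]

theorem exists_associated_isReducedPair_of_mul_pow_lt {ε δ : R} (hε : IsUnit ε) (hδ : IsUnit δ)
    {θ : ℝ} (hgε : 1 ≤ |g ε|) (hfδ : 1 ≤ |f δ|) (hθε : |f ε| * |g ε| ≤ θ) (hθδ : |f δ| * |g δ| ≤ θ)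
    {M : ℝ} (hM : 0 < M) (k : ℕ) (hf : M ≤ |f α|) (hg : M ≤ |g α|)
    (hk : |f α| * |g α| * θ ^ k < M ^ 2) :
    ∃ β, Associated α β ∧ IsReducedPair M (f ε) (g δ) (f β) (g β) := by
  induction k generalizing α with
  | zero =>
    have : M * M ≤ |f α| * |g α| := by gcongr
    linarith
  | succ k ih =>
    have hθ : 0 ≤ θ := le_trans (by positivity) hθε
    have hstep {η : R} (hη : IsUnit η) (hθη : |f η| * |g η| ≤ θ) (hfη : M ≤ |f (η * α)|)
        (hgη : M ≤ |g (η * α)|) :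
        ∃ β, Associated α β ∧ IsReducedPair M (f ε) (g δ) (f β) (g β) := by
      obtain ⟨β, hβ, hred⟩ := ih hfη hgη <|
        calc |f (η * α)| * |g (η * α)| * θ ^ k
            = |f η| * |g η| * (|f α| * |g α| * θ ^ k) := by
              simp only [map_mul, abs_mul]
              ring
          _ ≤ θ * (|f α| * |g α| * θ ^ k) := by gcongr
          _ = |f α| * |g α| * θ ^ (k + 1) := by ring
          _ < M ^ 2 := hk
      exact ⟨β, (associated_unit_mul_right α η hη).trans hβ, hred⟩
    by_cases hfε : M ≤ |f ε * f α|
    · refine hstep hε hθε (by rwa [map_mul]) ?_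
      rw [map_mul, abs_mul]
      exact hg.trans (le_mul_of_one_le_left (abs_nonneg _) hgε)
    by_cases hgδ : M ≤ |g δ * g α|
    · refine hstep hδ hθδ ?_ (by rwa [map_mul])
      rw [map_mul, abs_mul]
      exact hf.trans (le_mul_of_one_le_left (abs_nonneg _) hfδ)
    exact ⟨α, .refl α, hf, hg, not_le.1 hfε, not_le.1 hgδ⟩

-- A power of `ω` makes both absolute values large. Multiply by `ε` or `δ` as long as both values
-- stay at least `M`: each time their product shrinks by a factor bounded by some `θ < 1`.
theorem exists_associated_isReducedPair {ω ε δ : R} (hω : IsUnit ω) (hε : IsUnit ε) (hδ : IsUnit δ)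
    (hfω : 1 < |f ω|) (hgω : 1 < |g ω|) (hgε : 1 ≤ |g ε|) (hfδ : 1 ≤ |f δ|)
    (hε' : |f ε| * |g ε| < 1) (hδ' : |f δ| * |g δ| < 1) (hfα : f α ≠ 0) (hgα : g α ≠ 0)
    {M : ℝ} (hM : 0 < M) :
    ∃ β, Associated α β ∧ IsReducedPair M (f ε) (g δ) (f β) (g β) := by
  obtain ⟨β, hβ, hf, hg⟩ := exists_associated_le_abs hω hfω hgω hfα hgα M
  have hpos : 0 < |f β| * |g β| := mul_pos (hM.trans_le hf) (hM.trans_le hg)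
  obtain ⟨k, hk⟩ := exists_pow_lt_of_lt_one (div_pos (pow_pos hM 2) hpos) (max_lt hε' hδ')
  obtain ⟨γ, hγ, hred⟩ := exists_associated_isReducedPair_of_mul_pow_lt hε hδ hgε hfδ
    (le_max_left _ _) (le_max_right _ _) hM k hf hg ((lt_div_iff₀' hpos).1 hk)
  exact ⟨γ, hβ.trans hγ, hred⟩

theorem abs_map_eq_of_associated (hf : ∀ α, ∃ n : ℤ, f α = n) {β : R}
    (h : Associated α β) : |f α| = |f β| := by
  obtain ⟨u, rfl⟩ := h
  obtain ⟨n, hn⟩ := hf u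
  obtain ⟨m, hm⟩ := hf ↑u⁻¹
  have hnm : n * m = 1 := by
    have : (n : ℝ) * m = 1 := by rw [← hn, ← hm, ← map_mul, u.mul_inv, map_one]
    exact_mod_cast this
  have hunit : |(n : ℝ)| = 1 := mod_cast Int.isUnit_iff_abs_eq.1 (.of_mul_eq_one m hnm)
  rw [map_mul, abs_mul, hn, hunit, mul_one]

end Reduction

section Order

variable {R : Type*} [CommRing R] {a : ℤ} {r : R} {σ₁ σ₂ σ₃ : R →+* ℝ} {α : R}

theorem exists_associated_reduced (ha : 3 ≤ a) (hr : r * (r - 1) * (r + a) = 1)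
    (h : EnnolaConjugates a (σ₁ r) (σ₂ r) (σ₃ r)) (hα₁ : σ₁ α ≠ 0) (hα₂ : σ₂ α ≠ 0)
    {M : ℝ} (hM : 0 < M) :
    ∃ β, Associated α β ∧ IsReducedPair M (σ₁ r - 1) (σ₂ r) (σ₁ β) (σ₂ β) := by
  have ha' : (3 : ℝ) ≤ a := mod_cast ha
  have hadd : IsUnit (r + a) := .of_mul_eq_one (r * (r - 1)) (by linear_combination hr)
  have hsub : IsUnit (r - 1) := .of_mul_eq_one (r * (r + a)) (by linear_combination hr)
  have hself : IsUnit r := .of_mul_eq_one ((r - 1) * (r + a)) (by linear_combination hr)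
  have hred := exists_associated_isReducedPair (f := σ₁) (g := σ₂) (α := α) (M := M) hadd hsub hself
  simp only [map_add, map_sub, map_one, map_intCast] at hred
  have h₁ := h.one_lt
  obtain ⟨h₂, h₂'⟩ := h.mem_Ioo₂
  have ht := h.sub_one_mul_le_one (by lia)
  have hs := h.neg_mul_le_one (by lia)
  refine hred (lt_abs.2 (.inl ?_)) (lt_abs.2 (.inl ?_)) (le_abs.2 (.inr ?_)) (le_abs.2 (.inl ?_))
    ?_ ?_ hα₁ hα₂ hM
  · linarith
  · linarith
  · linarith
  · linarith
  · rw [abs_of_pos (by linarith), abs_of_neg (by linarith)]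
    nlinarith
  · rw [abs_of_pos (by linarith), abs_of_neg h₂']
    nlinarith

theorem normForm_eq_zero_iff (ha : 2 ≤ a) {x y z : ℤ} :
    normForm a x y z = 0 ↔ x = 0 ∧ y = 0 ∧ z = 0 := by
  refine ⟨fun h => ?_, by rintro ⟨rfl, rfl, rfl⟩; simp [normForm]⟩
  obtain ⟨r₁, r₂, r₃, hr⟩ := exists_ennolaConjugates ha
  have hprod := hr.ofCoords_mul_ofCoords_mul_ofCoords ha x y z
  rw [h, Int.cast_zero, mul_eq_zero, mul_eq_zero] at hprod
  rwa [ofCoords_eq_zero_iff hr.root₁, ofCoords_eq_zero_iff hr.root₂,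
    ofCoords_eq_zero_iff hr.root₃, or_self, or_self] at hprod

theorem abs_normForm_eq_of_associated (ha : 2 ≤ a)
    (hspan : ∀ α : R, ∃ x y z, ofCoords a r x y z = α)
    (h : EnnolaConjugates a (σ₁ r) (σ₂ r) (σ₃ r)) {x y z x' y' z' : ℤ}
    (hα : Associated (ofCoords a r x y z) (ofCoords a r x' y' z')) :
    |normForm a x y z| = |normForm a x' y' z'| := by
  let N : R →* ℝ := (σ₁ : R →* ℝ) * σ₂ * σ₃
  have hN (x y z : ℤ) : N (ofCoords a r x y z) = normForm a x y z := by
    rw [← h.ofCoords_mul_ofCoords_mul_ofCoords ha]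
    simp [N, map_ofCoords]
  have hNint (β : R) : ∃ n : ℤ, N β = n :=
    let ⟨x, y, z, hβ⟩ := hspan β
    ⟨normForm a x y z, hβ ▸ hN x y z⟩
  have habs := abs_map_eq_of_associated hNint hα
  rw [hN, hN] at habs
  exact_mod_cast habs

theorem le_abs_normForm_or_exists_associated_intCast (ha : 3 ≤ a)
    (hr : r * (r - 1) * (r + a) = 1) (hspan : ∀ α : R, ∃ x y z, ofCoords a r x y z = α)
    (h : EnnolaConjugates a (σ₁ r) (σ₂ r) (σ₃ r)) (x y z : ℤ) :
    2 * a - 3 ≤ |normForm a x y z| ∨ ∃ n : ℤ, Associated (ofCoords a r x y z) (n : R) := by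
  have ha' : (3 : ℝ) ≤ a := mod_cast ha
  by_cases h0 : normForm a x y z = 0
  · obtain ⟨rfl, rfl, rfl⟩ := (normForm_eq_zero_iff (by lia)).1 h0
    exact .inr ⟨0, by simp [ofCoords]⟩
  have hprod : (normForm a x y z : ℝ) ≠ 0 := mod_cast h0
  rw [← h.ofCoords_mul_ofCoords_mul_ofCoords (by lia)] at hprod
  simp only [← map_ofCoords, mul_ne_zero_iff] at hprod
  have hM : (0 : ℝ) < √(2 * a - 4) := Real.sqrt_pos.2 (by linarith)
  obtain ⟨β, hβ, hred⟩ := exists_associated_reduced ha hr h hprod.1.1 hprod.1.2 hM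
  obtain ⟨x', y', z', rfl⟩ := hspan β
  rw [abs_normForm_eq_of_associated (by lia) hspan h hβ]
  rw [map_ofCoords, map_ofCoords] at hred
  exact (h.le_abs_normForm_or_isIntMulUnit ha hM (Real.sq_sqrt (by linarith)) hred).imp_right
    fun ⟨m, hx, hy, hz, hm⟩ => ⟨m, hβ.trans (associated_intCast_of_abs_normForm_eq hr hx hy hz hm)⟩

theorem neg_one_add_sq_eq_ofCoords (a : ℤ) (r : R) :
    -1 + r ^ 2 = ofCoords a r (a ^ 2 - 1) (1 - a) a := by
  simp only [ofCoords]; push_cast; ring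

theorem abs_normForm_neg_one_add_sq (ha : 2 ≤ a) :
    |normForm a (a ^ 2 - 1) (1 - a) a| = 2 * a - 3 := by
  rw [show normForm a (a ^ 2 - 1) (1 - a) a = -(2 * a - 3) by simp only [normForm]; ring, abs_neg,
    abs_of_pos (by lia)]

theorem intCast_dvd_ofCoords_iff [IsDomain R] [CharZero R] (hr : r * (r - 1) * (r + a) = 1)
    (hspan : ∀ α : R, ∃ x y z, ofCoords a r x y z = α) {n x y z : ℤ} :
    (n : R) ∣ ofCoords a r x y z ↔ n ∣ x ∧ n ∣ y ∧ n ∣ z := by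
  constructor
  · rintro ⟨β, hβ⟩
    obtain ⟨x', y', z', rfl⟩ := hspan β
    have hsub : ofCoords a r (x - n * x') (y - n * y') (z - n * z') = 0 := by
      rw [← ofCoords_intCast_mul, ← sub_eq_zero] at hβ
      rw [← hβ]
      simp only [ofCoords]; push_cast; ring
    simp only [ofCoords_eq_zero_iff hr, sub_eq_zero] at hsub
    exact hsub.imp (Dvd.intro _ ·.symm) (.imp (Dvd.intro _ ·.symm) (Dvd.intro _ ·.symm))
  · rintro ⟨⟨x, rfl⟩, ⟨y, rfl⟩, ⟨z, rfl⟩⟩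
    rw [ofCoords_intCast_mul]
    exact dvd_mul_right _ _

theorem not_associated_neg_one_add_sq_intCast [IsDomain R] [CharZero R] (ha : 3 ≤ a)
    (hr : r * (r - 1) * (r + a) = 1) (hspan : ∀ α : R, ∃ x y z, ofCoords a r x y z = α)
    (h : EnnolaConjugates a (σ₁ r) (σ₂ r) (σ₃ r)) (n : ℤ) : ¬ Associated (-1 + r ^ 2) (n : R) := by
  intro hn
  rw [neg_one_add_sq_eq_ofCoords a] at hn
  obtain ⟨-, hn₁, hn₂⟩ := (intCast_dvd_ofCoords_iff hr hspan).1 hn.symm.dvd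
  have hunit : IsUnit n := isUnit_of_dvd_one <| by simpa using dvd_add hn₁ hn₂
  have hone : Associated (n : R) (ofCoords a r 1 0 0) := by
    simpa [ofCoords] using associated_one_iff_isUnit.2 (hunit.map (Int.castRingHom R))
  have hnorm := abs_normForm_eq_of_associated (by lia) hspan h (hn.trans hone)
  have hnorm_one : normForm a 1 0 0 = 1 := by simp [normForm]
  rw [abs_normForm_neg_one_add_sq (by lia), hnorm_one, abs_one] at hnorm
  lia

end Order

section NumberField

open IntermediateField

variable {a : ℤ} {ρ : ℝ}

theorem minpoly_rat_eq_map_ennolaPoly (hρ : ρ * (ρ - 1) * (ρ + a) = 1) :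
    minpoly ℚ ρ = (ennolaPoly a).map (algebraMap ℤ ℚ) := by
  rw [minpoly.isIntegrallyClosed_eq_field_fractions' ℚ (isIntegral_root hρ),
    minpoly_int_eq_ennolaPoly hρ]

theorem finrank_adjoin_root (hρ : ρ * (ρ - 1) * (ρ + a) = 1) : Module.finrank ℚ ℚ⟮ρ⟯ = 3 := by
  rw [adjoin.finrank (isIntegral_root hρ).tower_top, minpoly_rat_eq_map_ennolaPoly hρ,
    (monic_ennolaPoly a).natDegree_map, natDegree_ennolaPoly]

theorem exists_algHom_gen_eq (hρ : ρ * (ρ - 1) * (ρ + a) = 1) {r : ℝ}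
    (hr : r * (r - 1) * (r + a) = 1) : ∃ σ : ℚ⟮ρ⟯ →ₐ[ℚ] ℝ, σ (AdjoinSimple.gen ℚ ρ) = r := by
  refine ⟨(adjoin.powerBasis (isIntegral_root hρ).tower_top).lift r ?_,
    (adjoin.powerBasis (isIntegral_root hρ).tower_top).lift_gen r _⟩
  rw [adjoin.powerBasis_gen, minpoly_gen, minpoly_rat_eq_map_ennolaPoly hρ,
    Polynomial.aeval_map_algebraMap, aeval_ennolaPoly, hr, sub_self]

theorem exists_algHom_ennolaConjugates (ha : 2 ≤ a) (hρ : ρ * (ρ - 1) * (ρ + a) = 1) :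
    ∃ σ₁ σ₂ σ₃ : ℚ⟮ρ⟯ →ₐ[ℚ] ℝ, EnnolaConjugates a (σ₁ (AdjoinSimple.gen ℚ ρ))
      (σ₂ (AdjoinSimple.gen ℚ ρ)) (σ₃ (AdjoinSimple.gen ℚ ρ)) := by
  obtain ⟨r₁, r₂, r₃, h⟩ := exists_ennolaConjugates ha
  obtain ⟨σ₁, rfl⟩ := exists_algHom_gen_eq hρ h.root₁
  obtain ⟨σ₂, rfl⟩ := exists_algHom_gen_eq hρ h.root₂
  obtain ⟨σ₃, rfl⟩ := exists_algHom_gen_eq hρ h.root₃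
  exact ⟨σ₁, σ₂, σ₃, h⟩

theorem norm_ofCoords (ha : 2 ≤ a) (hρ : ρ * (ρ - 1) * (ρ + a) = 1) (x y z : ℤ) :
    Algebra.norm ℚ (ofCoords a (AdjoinSimple.gen ℚ ρ) x y z) = normForm a x y z := by
  obtain ⟨σ₁, σ₂, σ₃, h⟩ := exists_algHom_ennolaConjugates ha hρ
  have hfin : FiniteDimensional ℚ ℚ⟮ρ⟯ :=
    adjoin.finiteDimensional (isIntegral_root hρ).tower_top
  have hinj : Function.Injective ![σ₁, σ₂, σ₃] := by
    refine .of_comp (f := fun σ => σ (AdjoinSimple.gen ℚ ρ)) ?_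
    convert h.injective ha using 1
    ext i
    fin_cases i <;> rfl
  have hnorm := algebraMap_norm_eq_prod_of_injective hinj
    (by rw [Fintype.card_fin, finrank_adjoin_root hρ]) (ofCoords a (AdjoinSimple.gen ℚ ρ) x y z)
  refine (algebraMap ℚ ℝ).injective (hnorm.trans ?_)
  rw [map_intCast, ← h.ofCoords_mul_ofCoords_mul_ofCoords ha, Fin.prod_univ_three]
  simp [ofCoords]

theorem rootInOrder_root (hρ : ρ * (ρ - 1) * (ρ + a) = 1) :
    rootInOrder ρ * (rootInOrder ρ - 1) * (rootInOrder ρ + a) = 1 :=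
  Subtype.ext <| Subtype.ext <| by simpa [rootInOrder] using hρ

theorem coe_ofCoords_rootInOrder (x y z : ℤ) :
    ((ofCoords a (rootInOrder ρ) x y z : rootOrder ρ) : ℚ⟮ρ⟯) =
      ofCoords a (AdjoinSimple.gen ℚ ρ) x y z :=
  map_ofCoords (algebraMap (rootOrder ρ) ℚ⟮ρ⟯) x y z

theorem exists_ofCoords_rootInOrder_eq (hρ : ρ * (ρ - 1) * (ρ + a) = 1) (α : rootOrder ρ) :
    ∃ x y z, ofCoords a (rootInOrder ρ) x y z = α := by
  have hgen : AdjoinSimple.gen ℚ ρ * (AdjoinSimple.gen ℚ ρ - 1) * (AdjoinSimple.gen ℚ ρ + a) = 1 :=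
    Subtype.ext <| by simpa using hρ
  obtain ⟨x, y, z, h⟩ := exists_ofCoords_eq_of_mem_adjoin hgen α.2
  exact ⟨x, y, z, Subtype.ext ((coe_ofCoords_rootInOrder x y z).trans h)⟩

theorem norm_ofCoords_rootInOrder (ha : 2 ≤ a) (hρ : ρ * (ρ - 1) * (ρ + a) = 1) (x y z : ℤ) :
    Algebra.norm ℚ ((ofCoords a (rootInOrder ρ) x y z : rootOrder ρ) : ℚ⟮ρ⟯) =
      normForm a x y z := by
  rw [coe_ofCoords_rootInOrder, norm_ofCoords ha hρ]

theorem exists_ringHom_ennolaConjugates (ha : 2 ≤ a) (hρ : ρ * (ρ - 1) * (ρ + a) = 1) :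
    ∃ σ₁ σ₂ σ₃ : rootOrder ρ →+* ℝ,
      EnnolaConjugates a (σ₁ (rootInOrder ρ)) (σ₂ (rootInOrder ρ)) (σ₃ (rootInOrder ρ)) :=
  let ⟨σ₁, σ₂, σ₃, h⟩ := exists_algHom_ennolaConjugates ha hρ
  let incl := algebraMap (rootOrder ρ) ℚ⟮ρ⟯
  ⟨(σ₁ : ℚ⟮ρ⟯ →+* ℝ).comp incl, (σ₂ : ℚ⟮ρ⟯ →+* ℝ).comp incl, (σ₃ : ℚ⟮ρ⟯ →+* ℝ).comp incl, h⟩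

end NumberField

theorem proposition3_general (a : ℤ) (ha : 3 ≤ a) (ρ : ℝ)
    (hroot : ρ ^ 3 + ((a : ℝ) - 1) * ρ ^ 2 - (a : ℝ) * ρ - 1 = 0) :
    (∀ α : rootOrder ρ,
      2 * (a : ℚ) - 3 ≤ |Algebra.norm ℚ (α : ℚ⟮ρ⟯)| ∨
        ∃ n : ℤ, Associated α (n : rootOrder ρ)) ∧
    (|Algebra.norm ℚ ((-1 + rootInOrder ρ ^ 2 : rootOrder ρ) : ℚ⟮ρ⟯)| = 2 * (a : ℚ) - 3 ∧
      ¬ ∃ n : ℤ, Associated (-1 + rootInOrder ρ ^ 2) (n : rootOrder ρ)) := by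
  have hρ : ρ * (ρ - 1) * (ρ + a) = 1 := by linear_combination hroot
  have ha₂ : 2 ≤ a := by lia
  have hr := rootInOrder_root hρ
  have hspan := exists_ofCoords_rootInOrder_eq hρ
  obtain ⟨σ₁, σ₂, σ₃, h⟩ := exists_ringHom_ennolaConjugates ha₂ hρ
  refine ⟨fun α => ?_, ?_, fun ⟨n, hn⟩ => not_associated_neg_one_add_sq_intCast ha hr hspan h n hn⟩
  · obtain ⟨x, y, z, rfl⟩ := hspan α
    rw [norm_ofCoords_rootInOrder ha₂ hρ]
    exact (le_abs_normForm_or_exists_associated_intCast ha hr hspan h x y z).imp_left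
      fun hle => by exact_mod_cast hle
  · rw [neg_one_add_sq_eq_ofCoords a, norm_ofCoords_rootInOrder ha₂ hρ]
    exact_mod_cast abs_normForm_neg_one_add_sq ha₂

theorem proposition3 (a : ℤ) (ha : 3 ≤ a) (ρ : ℝ) (hρ : 1 < ρ)
    (hroot : ρ ^ 3 + ((a : ℝ) - 1) * ρ ^ 2 - (a : ℝ) * ρ - 1 = 0) :
    (∀ α : rootOrder ρ,
      2 * (a : ℚ) - 3 ≤ |Algebra.norm ℚ (α : ℚ⟮ρ⟯)| ∨
        ∃ n : ℤ, Associated α (n : rootOrder ρ)) ∧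
    (|Algebra.norm ℚ ((-1 + rootInOrder ρ ^ 2 : rootOrder ρ) : ℚ⟮ρ⟯)| = 2 * (a : ℚ) - 3 ∧
      ¬ ∃ n : ℤ, Associated (-1 + rootInOrder ρ ^ 2) (n : rootOrder ρ)) :=
  proposition3_general a ha ρ hroot
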